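/- Let $R$ be a semiperfect ring that is left and right noetherian, and let $e \in R$ be an idempotent. All modules are right modules, $\operatorname{mod} R$ is the category of finitely generated $R$-modules, $\Gamma_e := (1-e)R(1-e)$ is the ring with unit $1-e$, $F_e := - \otimes_R R(1-e)$ is the functor from $R$-modules to $\Gamma_e$-modules, and $\langle 1-e\rangle$ is the two-sided ideal of $R$ generated by $1-e$. The category $\operatorname{mod} R/\langle 1-e\rangle$ is regarded as the full subcategory of $\operatorname{mod} R$ of the modules annihilated by $\langle 1-e\rangle$. A $\operatorname{mod} R/\langle 1-e\rangle$-envelope of $M \in \operatorname{mod} R$ is a morphism $f \colon M \to X$ with $X \in \operatorname{mod} R/\langle 1-e\rangle$ such that every morphism from $M$ to an object of $\operatorname{mod} R/\langle 1-e\rangle$ factors through $f$ and every endomorphism $g$ of $X$ with $g \circ f = f$ is an isomorphism. Let $\Omega_0 \in \operatorname{mod} R$, and for all $i \in \mathbb{N}$ (including $0$) define inductively (1) $f_i \colon \Omega_i \to X_i$ as a $\operatorname{mod} R/\langle 1-e\rangle$-envelope of $\Omega_i$, (2) $k_i \colon K_i \to \Omega_i$ as a kernel of $f_i$, (3) $g_i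 \colon P_i \to K_i$ as a projective cover of $K_i$, and (4) $h_i \colon \Omega_{i+1} \to P_i$ as a kernel of $g_i$. Then for every such choice and every $i \geq 1$ there is an isomorphism of right $R$-modules $$\operatorname{Tor}_i^{\Gamma_e}(F_e(\Omega_0), (1-e)R) \cong X_{i+1},$$ where $\operatorname{Tor}_i^{\Gamma_e}(-, (1-e)R)$ is the $i$-th left derived functor of the functor $- \otimes_{\Gamma_e} (1-e)R$ from right $\Gamma_e$-modules to right $R$-modules. -/

import Mathlib

open CategoryTheory MulOpposite
open scoped TensorProduct

universe u v w

/-! Right modules over a ring `R` are modules over `Rᵐᵒᵖ`: `m · r` is written `op r • m`.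
The category `mod R` of finitely generated right `R`-modules is `FGModuleCat Rᵐᵒᵖ`, and the
category of all right `R`-modules is `ModuleCat Rᵐᵒᵖ`. -/

/-- A ring is semiperfect if it is semisimple modulo its Jacobson radical `J` and idempotents
lift modulo `J`. -/
structure IsSemiperfectRing (R : Type u) [Ring R] : Prop where
  isSemisimpleRing_quotient : IsSemisimpleRing (R ⧸ Ring.jacobson R)
  exists_lift : ∀ a : R, a * a - a ∈ Ring.jacobson R →
    ∃ f : R, IsIdempotentElem f ∧ f - a ∈ Ring.jacobson R

/-! ### Tensor products over a noncommutative ring -/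

namespace NCTensor

section

variable (S : Type u) (R : Type u) [Ring S] [Ring R]
variable (B : Type u) [AddCommGroup B] [Module S B] [Module Rᵐᵒᵖ B] [SMulCommClass S Rᵐᵒᵖ B]
variable (M : Type u) [AddCommGroup M] [Module Sᵐᵒᵖ M]

/-- For a right `S`-module `M` and an `(S, R)`-bimodule `B`, the relations
`m · s ⊗ b = m ⊗ s · b` defining `M ⊗_S B` as a quotient of `M ⊗_ℤ B`. The two factors are written
in the order `B ⊗[ℤ] M`, so that the right action of `R` is the one on the first factor. As the
set of relations is stable under the right action of `R`, its `R`-span is the subgroup that it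
generates. -/
def relations : Submodule Rᵐᵒᵖ (B ⊗[ℤ] M) :=
  Submodule.span Rᵐᵒᵖ
    {t | ∃ (s : S) (b : B) (m : M), t = b ⊗ₜ[ℤ] (op s • m) - (s • b) ⊗ₜ[ℤ] m}

/-- The right `R`-module `M ⊗_S B`, for a right `S`-module `M` and an `(S, R)`-bimodule `B`. -/
abbrev Tensor : Type u := (B ⊗[ℤ] M) ⧸ relations S R B M

variable {M}
variable {N : Type u} [AddCommGroup N] [Module Sᵐᵒᵖ N]

/-- The map `φ ⊗_ℤ B` on the tensor products over `ℤ`. -/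
def preMap (φ : M →ₗ[Sᵐᵒᵖ] N) : B ⊗[ℤ] M →ₗ[Rᵐᵒᵖ] B ⊗[ℤ] N :=
  TensorProduct.AlgebraTensorModule.map (LinearMap.id : B →ₗ[Rᵐᵒᵖ] B)
    (φ.toAddMonoidHom.toIntLinearMap)

set_option linter.unusedSectionVars false in
lemma relations_le (φ : M →ₗ[Sᵐᵒᵖ] N) :
    relations S R B M ≤ (relations S R B N).comap (preMap S R B φ) := by
  refine Submodule.span_le.2 ?_
  rintro _ ⟨s, b, m, rfl⟩
  refine Submodule.subset_span ⟨s, b, φ m, ?_⟩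
  simp [preMap]

/-- The map `φ ⊗_S B : M ⊗_S B → N ⊗_S B`. -/
def map (φ : M →ₗ[Sᵐᵒᵖ] N) : Tensor S R B M →ₗ[Rᵐᵒᵖ] Tensor S R B N :=
  Submodule.mapQ _ _ (preMap S R B φ) (relations_le S R B φ)

set_option linter.unusedSectionVars false in
lemma tensor_hom_ext {Q : Type u} [AddCommGroup Q] [Module Rᵐᵒᵖ Q]
    {φ ψ : Tensor S R B M →ₗ[Rᵐᵒᵖ] Q}
    (h : ∀ (b : B) (m : M), φ (Submodule.Quotient.mk (b ⊗ₜ[ℤ] m)) =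
      ψ (Submodule.Quotient.mk (b ⊗ₜ[ℤ] m))) : φ = ψ := by
  refine Submodule.linearMap_qext _ (LinearMap.ext fun t => ?_)
  induction t using TensorProduct.induction_on with
  | zero => rw [map_zero, map_zero]
  | tmul b m => exact h b m
  | add a b ha hb => rw [map_add, map_add, ha, hb]

lemma map_mk (φ : M →ₗ[Sᵐᵒᵖ] N) (b : B) (m : M) :
    map S R B φ (Submodule.Quotient.mk (b ⊗ₜ[ℤ] m)) = Submodule.Quotient.mk (b ⊗ₜ[ℤ] φ m) :=
  rfl

end

section

variable (S : Type u) (R : Type u) [Ring S] [Ring R]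
variable (B : Type u) [AddCommGroup B] [Module S B] [Module Rᵐᵒᵖ B] [SMulCommClass S Rᵐᵒᵖ B]

/-- The functor `- ⊗_S B` from right `S`-modules to right `R`-modules, for an
`(S, R)`-bimodule `B`. -/
noncomputable def functor : ModuleCat.{u} Sᵐᵒᵖ ⥤ ModuleCat.{u} Rᵐᵒᵖ where
  obj M := ModuleCat.of Rᵐᵒᵖ (Tensor S R B M)
  map φ := ModuleCat.ofHom (map S R B φ.hom)
  map_id _ := ModuleCat.hom_ext (tensor_hom_ext S R B fun _ _ => rfl)
  map_comp _ _ := ModuleCat.hom_ext (tensor_hom_ext S R B fun _ _ => rfl)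

instance : (functor S R B).Additive where
  map_add {M N φ ψ} := ModuleCat.hom_ext <| tensor_hom_ext S R B fun b m => by
    change map S R B (φ.hom + ψ.hom) _ = map S R B φ.hom _ + map S R B ψ.hom _
    rw [map_mk, map_mk, map_mk, LinearMap.add_apply, TensorProduct.tmul_add,
      Submodule.Quotient.mk_add]

/-- `Tor_i^S(-, B)`, as a functor from right `S`-modules to right `R`-modules, for an
`(S, R)`-bimodule `B`: the `i`-th left derived functor of `- ⊗_S B`. -/
noncomputable def Tor (i : ℕ) : ModuleCat.{u} Sᵐᵒᵖ ⥤ ModuleCat.{u} Rᵐᵒᵖ :=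
  (functor S R B).leftDerived i

end

end NCTensor

/-! ### The bimodules `Rf` and `fR` for an idempotent `f` -/

section

variable {R : Type u} [Ring R]

/-- The left ideal `Rf`. -/
abbrev leftIdeal (f : R) : Submodule R R := Submodule.span R {f}

/-- The right ideal `fR`. -/
abbrev rightIdeal (f : R) : Submodule Rᵐᵒᵖ R := Submodule.span Rᵐᵒᵖ {f}

variable {f : R} {hf : IsIdempotentElem f}

lemma mul_corner_mem (x : R) (c : hf.Corner) : x * c.1 ∈ leftIdeal f := by
  obtain ⟨-, h⟩ := (Subsemigroup.mem_corner_iff hf).1 c.2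
  rw [← h, ← mul_assoc]
  exact Submodule.mem_span_singleton.2 ⟨x * c.1, rfl⟩

lemma corner_mul_mem (c : hf.Corner) (x : R) : c.1 * x ∈ rightIdeal f := by
  obtain ⟨h, -⟩ := (Subsemigroup.mem_corner_iff hf).1 c.2
  rw [← h, mul_assoc]
  exact Submodule.mem_span_singleton.2 ⟨op (c.1 * x), rfl⟩

lemma mul_idem_of_mem {x : R} (hf : IsIdempotentElem f) (hx : x ∈ leftIdeal f) : x * f = x := by
  obtain ⟨a, rfl⟩ := Submodule.mem_span_singleton.1 hx
  rw [smul_eq_mul, mul_assoc, hf.eq]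

lemma idem_mul_of_mem {x : R} (hf : IsIdempotentElem f) (hx : x ∈ rightIdeal f) : f * x = x := by
  obtain ⟨a, rfl⟩ := Submodule.mem_span_singleton.1 hx
  change f * (f * unop a) = f * unop a
  rw [← mul_assoc, hf.eq]

/-- `Rf` is a right `fRf`-module under right multiplication. -/
instance : Module (hf.Corner)ᵐᵒᵖ (leftIdeal f) where
  smul c x := ⟨x.1 * (unop c).1, mul_corner_mem x.1 (unop c)⟩
  one_smul x := Subtype.ext (mul_idem_of_mem hf x.2)
  mul_smul c d x := Subtype.ext (mul_assoc x.1 (unop d).1 (unop c).1).symm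
  smul_zero _ := Subtype.ext (zero_mul _)
  smul_add _ _ _ := Subtype.ext (add_mul _ _ _)
  add_smul _ _ _ := Subtype.ext (mul_add _ _ _)
  zero_smul _ := Subtype.ext (mul_zero _)

/-- `fR` is a left `fRf`-module under left multiplication. -/
instance : Module hf.Corner (rightIdeal f) where
  smul c x := ⟨c.1 * x.1, corner_mul_mem c x.1⟩
  one_smul x := Subtype.ext (idem_mul_of_mem hf x.2)
  mul_smul c d x := Subtype.ext (mul_assoc c.1 d.1 x.1)
  smul_zero _ := Subtype.ext (mul_zero _)
  smul_add _ _ _ := Subtype.ext (mul_add _ _ _)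
  add_smul _ _ _ := Subtype.ext (add_mul _ _ _)
  zero_smul _ := Subtype.ext (zero_mul _)

instance : SMulCommClass R (hf.Corner)ᵐᵒᵖ (leftIdeal f) where
  smul_comm r c x := Subtype.ext (mul_assoc r x.1 (unop c).1).symm

instance : SMulCommClass hf.Corner Rᵐᵒᵖ (rightIdeal f) where
  smul_comm c r x := Subtype.ext (mul_assoc c.1 x.1 (unop r)).symm

variable {e : R}

/-- The idempotent subring `Γ_e = (1 - e)R(1 - e)`, with unit `1 - e`. -/
abbrev Gam (he : IsIdempotentElem e) : Type u := he.one_sub.Corner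

/-- The functor `F_e = - ⊗_R R(1 - e)` from right `R`-modules to right `Γ_e`-modules. -/
noncomputable abbrev functorF (he : IsIdempotentElem e) :
    ModuleCat.{u} Rᵐᵒᵖ ⥤ ModuleCat.{u} (Gam he)ᵐᵒᵖ :=
  NCTensor.functor R (Gam he) (leftIdeal (1 - e))

/-- `Tor_i^{Γ_e}(-, (1 - e)R)`, the `i`-th left derived functor of the functor
`G_e = - ⊗_{Γ_e} (1 - e)R` from right `Γ_e`-modules to right `R`-modules. -/
noncomputable abbrev torGam (he : IsIdempotentElem e) (i : ℕ) :
    ModuleCat.{u} (Gam he)ᵐᵒᵖ ⥤ ModuleCat.{u} Rᵐᵒᵖ :=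
  NCTensor.Tor (Gam he) R (rightIdeal (1 - e)) i

end

/-! ### Envelopes, projective covers and the construction -/

/-- A morphism `f : C ⟶ X` is an `𝒳`-envelope, for a full subcategory `𝒳`, if `X` lies in `𝒳`,
every morphism from `C` to an object of `𝒳` factors through `f`, and every endomorphism `g`
of `X` with `f ≫ g = f` is an isomorphism. -/
structure IsEnvelope {𝒞 : Type u} [Category.{v} 𝒞] (𝒳 : ObjectProperty 𝒞) {C X : 𝒞}
    (f : C ⟶ X) : Prop where
  mem : 𝒳 X
  exists_factor : ∀ X' : 𝒞, 𝒳 X' → ∀ t : C ⟶ X', ∃ s : X ⟶ X', f ≫ s = t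
  isIso_of_comp_eq : ∀ g : X ⟶ X, f ≫ g = f → IsIso g

/-- A linear map `g : P → K` is a projective cover if `P` is projective and `g` is surjective
with superfluous kernel. -/
structure IsProjectiveCover {A : Type u} [Ring A] {P : Type v} {K : Type w} [AddCommGroup P]
    [Module A P] [AddCommGroup K] [Module A K] (g : P →ₗ[A] K) : Prop where
  projective : Module.Projective A P
  surjective : Function.Surjective g
  superfluous : ∀ N : Submodule A P, N ⊔ LinearMap.ker g = ⊤ → N = ⊤

/-- `k` is injective with image the kernel of `f`. -/
structure IsKernelOf {A : Type u} [Ring A] {K M N : FGModuleCat.{u} A} (k : K ⟶ M)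
    (f : M ⟶ N) : Prop where
  injective : Function.Injective k.hom.hom
  exact : Function.Exact k.hom.hom f.hom.hom

/-- The full subcategory `mod R/⟨1 - e⟩` of `mod R`: the finitely generated right `R`-modules
annihilated by the two-sided ideal `⟨1 - e⟩`. -/
def modQuotient {R : Type u} [Ring R] (e : R) : ObjectProperty (FGModuleCat.{u} Rᵐᵒᵖ) :=
  fun M => ∀ r ∈ TwoSidedIdeal.span ({1 - e} : Set R), ∀ m : M, op r • m = 0

/-- The outcome of the inductive construction, for a finitely generated right `R`-module `Ω₀`:
starting with `Ω 0 = Ω₀`, the map `f i : Ω i ⟶ X i` is a `mod R/⟨1 - e⟩`-envelope of `Ω i`,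
`k i : K i ⟶ Ω i` is a kernel of `f i`, `g i : P i ⟶ K i` is a projective cover of `K i`, and
`h i : Ω (i + 1) ⟶ P i` is a kernel of `g i`. -/
structure EnvelopeConstruction {R : Type u} [Ring R] (e : R) (Ω₀ : FGModuleCat.{u} Rᵐᵒᵖ) where
  Ω : ℕ → FGModuleCat.{u} Rᵐᵒᵖ
  X : ℕ → FGModuleCat.{u} Rᵐᵒᵖ
  K : ℕ → FGModuleCat.{u} Rᵐᵒᵖ
  P : ℕ → FGModuleCat.{u} Rᵐᵒᵖ
  f : ∀ i, Ω i ⟶ X i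
  k : ∀ i, K i ⟶ Ω i
  g : ∀ i, P i ⟶ K i
  h : ∀ i, Ω (i + 1) ⟶ P i
  Ω_zero : Ω 0 = Ω₀
  isEnvelope : ∀ i, IsEnvelope (modQuotient e) (f i)
  isKernel_k : ∀ i, IsKernelOf (k i) (f i)
  isProjectiveCover : ∀ i, IsProjectiveCover (g i).hom.hom
  isKernel_h : ∀ i, IsKernelOf (h i) (g i)

/-! Write `f = 1 - e`. The envelope of `M` is the projection `M → M/M⟨f⟩`, so `K i` is `Ω i⟨f⟩`. It
is generated by its elements fixed by `f`, and hence so is its projective cover `P i`, which is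
therefore a summand of a sum of copies of `fR`.

Splicing `P (i+1) → Ω (i+1) → P i` gives a complex `P`. Its cycles in degree `i + 1` are `Ω (i+2)`
and its boundaries `Ω (i+2)⟨f⟩`, so the homology there is `X (i+2)` (`homologyIso`). This homology
is annihilated by `f`, and `M ↦ M ⊗ Rf ≅ Mf` is exact and kills such modules, so `F_e P` is a
resolution of `F_e (Ω 0)` (`exact_map_leftIdeal`), with projective terms
(`projective_cornerRestrict`). Tensoring back with `fR` recovers `P`, as the counit is bijective on
each `P i` (`cornerCounit_bijective`). Hence Tor is the homology of `P`. -/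

namespace NCTensor

/-! ### Balanced maps and pure tensors. -/

section

variable {S : Type u} {R : Type u} [Ring S] [Ring R]
variable {B : Type u} [AddCommGroup B] [Module S B] [Module Rᵐᵒᵖ B] [SMulCommClass S Rᵐᵒᵖ B]
variable {M : Type u} [AddCommGroup M] [Module Sᵐᵒᵖ M]

variable (S R) in
/-- The pure tensor `m ⊗ b` in `M ⊗_S B`. -/
def tmul (b : B) (m : M) : Tensor S R B M := Submodule.Quotient.mk (b ⊗ₜ[ℤ] m)

set_option linter.unusedSectionVars false in
lemma tmul_add (b : B) (m n : M) : tmul S R b (m + n) = tmul S R b m + tmul S R b n := by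
  rw [tmul, TensorProduct.tmul_add, Submodule.Quotient.mk_add]; rfl

set_option linter.unusedSectionVars false in
lemma add_tmul (b c : B) (m : M) : tmul S R (b + c) m = tmul S R b m + tmul S R c m := by
  rw [tmul, TensorProduct.add_tmul, Submodule.Quotient.mk_add]; rfl

set_option linter.unusedSectionVars false in
lemma tmul_zero (b : B) : tmul S R b (0 : M) = 0 := by
  rw [tmul, TensorProduct.tmul_zero, Submodule.Quotient.mk_zero]

set_option linter.unusedSectionVars false in
lemma zero_tmul (m : M) : tmul S R (0 : B) m = 0 := by
  rw [tmul, TensorProduct.zero_tmul, Submodule.Quotient.mk_zero]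

set_option linter.unusedSectionVars false in
lemma smul_tmul' (r : Rᵐᵒᵖ) (b : B) (m : M) : r • tmul S R b m = tmul S R (r • b) m := rfl

set_option linter.unusedSectionVars false in
lemma tmul_smul (s : S) (b : B) (m : M) : tmul S R b (op s • m) = tmul S R (s • b) m :=
  (Submodule.Quotient.eq _).2 (Submodule.subset_span ⟨s, b, m, rfl⟩)

set_option linter.unusedSectionVars false in
lemma tensor_induction {p : Tensor S R B M → Prop} (t : Tensor S R B M)
    (zero : p 0) (tmul : ∀ b m, p (tmul S R b m)) (add : ∀ x y, p x → p y → p (x + y)) : p t := by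
  obtain ⟨t, rfl⟩ := Submodule.Quotient.mk_surjective _ t
  induction t using TensorProduct.induction_on with
  | zero => exact zero
  | tmul b m => exact tmul b m
  | add a b ha hb => exact add _ _ ha hb

variable {Q : Type u} [AddCommGroup Q]

variable (R) in
/-- The additive map on `M ⊗_S B` induced by a balanced biadditive map. -/
def liftAdd (φ : B →+ M →+ Q) (hφ : ∀ (s : S) b m, φ b (op s • m) = φ (s • b) m) :
    Tensor S R B M →+ Q :=
  QuotientAddGroup.lift (relations S R B M).toAddSubgroup
    (TensorProduct.liftAddHom (R := ℤ) φ fun n b m => by simp) (by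
      -- The relations are an `R`-span while the map is only additive, so the induction must carry
      -- all multiples `r • t`.
      suffices h : ∀ t ∈ relations S R B M, ∀ r : Rᵐᵒᵖ,
          TensorProduct.liftAddHom (R := ℤ) φ (fun n b m => by simp) (r • t) = 0 from
        fun t ht => by simpa using h t ht 1
      intro t ht
      induction ht using Submodule.span_induction with
      | mem t ht =>
        obtain ⟨s, b, m, rfl⟩ := ht
        intro r
        rw [smul_sub, TensorProduct.smul_tmul', TensorProduct.smul_tmul', map_sub,
          TensorProduct.liftAddHom_tmul, TensorProduct.liftAddHom_tmul, hφ, smul_comm, sub_self]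
      | zero => simp
      | add x y _ _ hx hy => intro r; rw [smul_add, map_add, hx, hy, add_zero]
      | smul c x _ hx => intro r; rw [smul_smul, hx])

/-- The linear map on `M ⊗_S B` induced by a balanced biadditive map that is compatible with the
right action of `R`. -/
def lift [Module Rᵐᵒᵖ Q] (φ : B →+ M →+ Q) (hφ : ∀ (s : S) b m, φ b (op s • m) = φ (s • b) m)
    (hφ' : ∀ (r : Rᵐᵒᵖ) b m, φ (r • b) m = r • φ b m) : Tensor S R B M →ₗ[Rᵐᵒᵖ] Q where
  __ := liftAdd R φ hφ
  map_smul' r t := by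
    change liftAdd R φ hφ (r • t) = r • liftAdd R φ hφ t
    induction t using tensor_induction with
    | zero => simp
    | tmul b m => exact hφ' r b m
    | add x y hx hy => rw [smul_add, map_add, map_add, smul_add, hx, hy]

lemma map_tmul {N : Type u} [AddCommGroup N] [Module Sᵐᵒᵖ N] (φ : M →ₗ[Sᵐᵒᵖ] N) (b : B) (m : M) :
    map S R B φ (tmul S R b m) = tmul S R b (φ m) := rfl

end

end NCTensor

/-! ### Passage between `R` and the corner `fRf`. -/

section

open NCTensor

variable {R : Type u} [Ring R] {f : R} (hf : IsIdempotentElem f)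
variable {M N L : Type u} [AddCommGroup M] [Module Rᵐᵒᵖ M] [AddCommGroup N] [Module Rᵐᵒᵖ N]
  [AddCommGroup L] [Module Rᵐᵒᵖ L]

/-- The module `M ⊗_R Rf` over `fRf`. -/
abbrev cornerRestrict (M : Type u) [AddCommGroup M] [Module Rᵐᵒᵖ M] : Type u :=
  Tensor R hf.Corner (leftIdeal f) M

/-- The module `N ⊗_{fRf} fR` over `R`. -/
abbrev cornerExtend (N : Type u) [AddCommGroup N] [Module (hf.Corner)ᵐᵒᵖ N] : Type u :=
  Tensor hf.Corner R (rightIdeal f) N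

/-- The idempotent `f` as an element of `Rf`. -/
abbrev leftIdeal.gen (f : R) : leftIdeal f := ⟨f, Submodule.mem_span_singleton_self f⟩

/-- The idempotent `f` as an element of `fR`. -/
abbrev rightIdeal.gen (f : R) : rightIdeal f := ⟨f, Submodule.mem_span_singleton_self f⟩

/-- The multiplication map `M ⊗_R Rf → M`, with `m ⊗ b` sent to `m · b`. -/
noncomputable def cornerEval : cornerRestrict hf M →+ M :=
  liftAdd hf.Corner
    (AddMonoidHom.mk' (fun b : leftIdeal f => DistribSMul.toAddMonoidHom M (op b.1))
      fun b c => by ext m; simp [add_smul])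
    fun s b m => (mul_smul (op b.1) (op s) m).symm

lemma cornerEval_tmul (b : leftIdeal f) (m : M) :
    cornerEval hf (tmul R hf.Corner b m) = op b.1 • m := rfl

lemma cornerEval_smul (c : (hf.Corner)ᵐᵒᵖ) (t : cornerRestrict hf M) :
    cornerEval hf (c • t) = op (unop c).1 • cornerEval hf t := by
  induction t using tensor_induction with
  | zero => simp
  | tmul b m => exact mul_smul (op (unop c).1) (op b.1) m
  | add x y hx hy => rw [smul_add, map_add, map_add, smul_add, hx, hy]

lemma cornerEval_map (φ : M →ₗ[Rᵐᵒᵖ] N) (t : cornerRestrict hf M) :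
    cornerEval hf (map R hf.Corner (leftIdeal f) φ t) = φ (cornerEval hf t) := by
  induction t using tensor_induction with
  | zero => simp
  | tmul b m => exact (map_smul φ (op b.1) m).symm
  | add x y hx hy => rw [map_add, map_add, map_add, map_add, hx, hy]

lemma tmul_eq_gen_tmul (b : leftIdeal f) (m : M) :
    tmul R hf.Corner b m = tmul R hf.Corner (leftIdeal.gen f) (op b.1 • m) := by
  rw [tmul_smul]
  congr 1
  exact Subtype.ext (mul_idem_of_mem hf b.2).symm

/-- Moving `b = b f` across the tensor sign turns `m ⊗ b` into `m b ⊗ f`. Thus `cornerEval`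
identifies `M ⊗_R Rf` with `M f`, and later arguments compute in `M f`. -/
lemma gen_tmul_cornerEval (t : cornerRestrict hf M) :
    tmul R hf.Corner (leftIdeal.gen f) (cornerEval hf t) = t := by
  induction t using tensor_induction with
  | zero => rw [map_zero, tmul_zero]
  | tmul b m => rw [cornerEval_tmul, ← tmul_eq_gen_tmul]
  | add x y hx hy => rw [map_add, tmul_add, hx, hy]

lemma op_smul_cornerEval (t : cornerRestrict hf M) : op f • cornerEval hf t = cornerEval hf t := by
  conv_rhs => rw [← gen_tmul_cornerEval hf t]
  rfl

/-- Restriction to the corner `fRf` is exact at `N` when the homology at `N` of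
`M → N → L` is annihilated by `f`. -/
lemma exact_map_leftIdeal (φ : M →ₗ[Rᵐᵒᵖ] N) (ψ : N →ₗ[Rᵐᵒᵖ] L) (h₀ : ∀ m, ψ (φ m) = 0)
    (h : ∀ n, ψ n = 0 → ∃ m, φ m = op f • n) :
    Function.Exact (map R hf.Corner (leftIdeal f) φ) (map R hf.Corner (leftIdeal f) ψ) := by
  intro t
  constructor
  · intro ht
    have h1 : ψ (cornerEval hf t) = 0 := by rw [← cornerEval_map, ht, map_zero]
    obtain ⟨m, hm⟩ := h _ h1
    refine ⟨tmul R hf.Corner (leftIdeal.gen f) m, ?_⟩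
    rw [map_tmul, hm, op_smul_cornerEval, gen_tmul_cornerEval]
  · rintro ⟨t, rfl⟩
    rw [← gen_tmul_cornerEval hf t, map_tmul, map_tmul, h₀, tmul_zero]

lemma surjective_map_leftIdeal (φ : M →ₗ[Rᵐᵒᵖ] N) (h : ∀ n, ∃ m, φ m = op f • n) :
    Function.Surjective (map R hf.Corner (leftIdeal f) φ) := by
  intro t
  obtain ⟨m, hm⟩ := h (cornerEval hf t)
  refine ⟨tmul R hf.Corner (leftIdeal.gen f) m, ?_⟩
  rw [map_tmul, hm, op_smul_cornerEval, gen_tmul_cornerEval]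

/-- The counit `(M ⊗_R Rf) ⊗_{fRf} fR → M`, with `(m ⊗ b) ⊗ x` sent to `m · b x`. -/
noncomputable def cornerCounit : cornerExtend hf (cornerRestrict hf M) →ₗ[Rᵐᵒᵖ] M :=
  lift
    (AddMonoidHom.mk' (fun x : rightIdeal f =>
        (DistribSMul.toAddMonoidHom M (op x.1)).comp (cornerEval hf))
      fun b c => by ext m; simp [add_smul])
    (fun s x t => by
      change op x.1 • cornerEval hf (op s • t) = op (s.1 * x.1) • cornerEval hf t
      rw [cornerEval_smul, op_mul, mul_smul]; rfl)
    fun r x t => by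
      change op (x.1 * unop r) • cornerEval hf t = r • op x.1 • cornerEval hf t
      rw [op_mul, mul_smul]; rfl

lemma cornerCounit_tmul (x : rightIdeal f) (t : cornerRestrict hf M) :
    cornerCounit hf (tmul hf.Corner R x t) = op x.1 • cornerEval hf t := rfl

lemma cornerCounit_naturality (φ : M →ₗ[Rᵐᵒᵖ] N) (t : cornerExtend hf (cornerRestrict hf M)) :
    cornerCounit hf (map hf.Corner R (rightIdeal f) (map R hf.Corner (leftIdeal f) φ) t) =
      φ (cornerCounit hf t) := by
  induction t using tensor_induction with
  | zero => simp
  | tmul x t => rw [map_tmul, cornerCounit_tmul, cornerCounit_tmul, cornerEval_map, map_smul]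
  | add x y hx hy => rw [map_add, map_add, map_add, map_add, hx, hy]

variable (f M) in
/-- The canonical map from a direct sum of copies of `fR` onto `M · fR`. -/
noncomputable def idealCover : (M →₀ rightIdeal f) →ₗ[Rᵐᵒᵖ] M :=
  Finsupp.lsum ℕ fun m : M =>
    { toFun := fun x : rightIdeal f => op x.1 • m
      map_add' := fun x y => by simp [add_smul]
      map_smul' := fun r x => by
        change op (x.1 * unop r) • m = r • op x.1 • m
        rw [op_mul, mul_smul]; rfl }

lemma idealCover_single (m : M) (x : rightIdeal f) :
    idealCover f M (Finsupp.single m x) = op x.1 • m := by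
  simp [idealCover]

lemma idealCover_surjective
    (hM : Submodule.span Rᵐᵒᵖ (Set.range fun m : M => op f • m) = ⊤) :
    Function.Surjective (idealCover f M) := by
  rw [← LinearMap.range_eq_top, eq_top_iff, ← hM, Submodule.span_le]
  rintro _ ⟨m, rfl⟩
  exact ⟨Finsupp.single m (rightIdeal.gen f), idealCover_single m _⟩

/-- A projective module generated by `P f` is a direct summand of a direct sum of copies
of `fR`. -/
lemma exists_section_idealCover {P : Type u} [AddCommGroup P] [Module Rᵐᵒᵖ P]
    [Module.Projective Rᵐᵒᵖ P]
    (hP : Submodule.span Rᵐᵒᵖ (Set.range fun p : P => op f • p) = ⊤) :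
    ∃ σ : P →ₗ[Rᵐᵒᵖ] (P →₀ rightIdeal f), ∀ p, idealCover f P (σ p) = p := by
  obtain ⟨σ, hσ⟩ := Module.projective_lifting_property (idealCover f P) LinearMap.id
    (idealCover_surjective hP)
  exact ⟨σ, fun p => LinearMap.congr_fun hσ p⟩

variable (M) in
/-- The lift of `idealCover` along the counit. -/
noncomputable def idealCoverLift :
    (M →₀ rightIdeal f) →ₗ[Rᵐᵒᵖ] cornerExtend hf (cornerRestrict hf M) :=
  Finsupp.lsum ℕ fun m : M =>
    { toFun := fun x : rightIdeal f => tmul hf.Corner R x (tmul R hf.Corner (leftIdeal.gen f) m)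
      map_add' := fun _ _ => add_tmul _ _ _
      map_smul' := fun _ _ => rfl }

lemma idealCoverLift_single (m : M) (x : rightIdeal f) :
    idealCoverLift hf M (Finsupp.single m x) =
      tmul hf.Corner R x (tmul R hf.Corner (leftIdeal.gen f) m) := by
  rw [idealCoverLift, Finsupp.lsum_single]; rfl

lemma mul_mem_corner (hf : IsIdempotentElem f) (x : rightIdeal f) (b : leftIdeal f) :
    x.1 * b.1 ∈ Subsemigroup.corner f :=
  (Subsemigroup.mem_corner_iff hf).2
    ⟨by rw [← mul_assoc, idem_mul_of_mem hf x.2], by rw [mul_assoc, mul_idem_of_mem hf b.2]⟩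

/-- The product `xb` in `fRf` of `x` in `fR` and `b` in `Rf`. -/
def cornerMul (x : rightIdeal f) (b : leftIdeal f) : hf.Corner := ⟨x.1 * b.1, mul_mem_corner hf x b⟩

lemma cornerMul_add_left (x y : rightIdeal f) (b : leftIdeal f) :
    cornerMul hf (x + y) b = cornerMul hf x b + cornerMul hf y b :=
  Subtype.ext (add_mul x.1 y.1 b.1)

lemma cornerMul_add_right (x : rightIdeal f) (b c : leftIdeal f) :
    cornerMul hf x (b + c) = cornerMul hf x b + cornerMul hf x c :=
  Subtype.ext (mul_add x.1 b.1 c.1)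

lemma gen_mul_cornerMul (x : rightIdeal f) (b : leftIdeal f) :
    f * (cornerMul hf x b).1 = x.1 * b.1 := by
  change f * (x.1 * b.1) = x.1 * b.1
  rw [← mul_assoc, idem_mul_of_mem hf x.2]

lemma cornerCounit_idealCoverLift (y : M →₀ rightIdeal f) :
    cornerCounit hf (idealCoverLift hf M y) = idealCover f M y := by
  induction y using Finsupp.induction_linear with
  | zero => simp
  | add x y hx hy => rw [map_add, map_add, map_add, hx, hy]
  | single m x =>
    rw [idealCoverLift_single, idealCover_single, cornerCounit_tmul, cornerEval_tmul,
      ← mul_smul, ← op_mul, idem_mul_of_mem hf x.2]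

/-- For `y` concentrated at `m` with value `z`, the product `z b` lies in `fRf` and crosses the
outer tensor sign; then `z` alone crosses the inner one. This is what makes the counit injective. -/
lemma idealCoverLift_smul (x : rightIdeal f) (b : leftIdeal f) (y : M →₀ rightIdeal f) :
    idealCoverLift hf M (op (b.1 * x.1) • y) =
      tmul hf.Corner R x (tmul R hf.Corner b (idealCover f M y)) := by
  induction y using Finsupp.induction_linear with
  | zero => simp [tmul_zero]
  | add y z hy hz => rw [smul_add, map_add, map_add, tmul_add, tmul_add, hy, hz]
  | single m z =>
    have h : op (b.1 * x.1) • z = cornerMul hf z b • x :=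
      Subtype.ext (mul_assoc z.1 b.1 x.1).symm
    have h' : op (cornerMul hf z b) • leftIdeal.gen f = (z.1 • b : leftIdeal f) :=
      Subtype.ext (gen_mul_cornerMul hf z b)
    rw [Finsupp.smul_single, idealCoverLift_single, idealCover_single, h,
      ← tmul_smul (cornerMul hf z b) x, tmul_smul z.1 b m, smul_tmul', h']

/-- The counit is an isomorphism at projective modules generated by `P f`. -/
lemma cornerCounit_bijective {P : Type u} [AddCommGroup P] [Module Rᵐᵒᵖ P]
    [Module.Projective Rᵐᵒᵖ P]
    (hP : Submodule.span Rᵐᵒᵖ (Set.range fun p : P => op f • p) = ⊤) :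
    Function.Bijective (cornerCounit hf (M := P)) := by
  obtain ⟨σ, hσ⟩ := exists_section_idealCover hP
  -- The inverse lifts the splitting `σ` through the counit. On `(p ⊗ b) ⊗ x` the counit gives `p ·
  -- b x`, and linearity of `σ` reduces the claim to `idealCoverLift_smul`.
  refine Function.bijective_iff_has_inverse.2 ⟨fun p => idealCoverLift hf P (σ p), fun t => ?_,
    fun p => by rw [cornerCounit_idealCoverLift, hσ]⟩
  induction t using tensor_induction with
  | zero => simp
  | tmul x t =>
    induction t using tensor_induction with
    | zero => simp [tmul_zero]
    | tmul b p =>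
      dsimp only
      rw [cornerCounit_tmul, cornerEval_tmul, ← mul_smul, ← op_mul, map_smul,
        idealCoverLift_smul, hσ]
    | add y z hy hz => dsimp only at *; rw [tmul_add, map_add, map_add, map_add, hy, hz]
  | add y z hy hz => dsimp only at *; rw [map_add, map_add, map_add, hy, hz]

/-- A module onto which every surjection splits is projective. -/
lemma Module.Projective.of_surjective_splits {A : Type u} [Ring A] {Q : Type u} [AddCommGroup Q]
    [Module A Q]
    (h : ∀ (N : Type u) [AddCommGroup N] [Module A N] (ψ : N →ₗ[A] Q), Function.Surjective ψ →
      ∃ s : Q →ₗ[A] N, ψ ∘ₗ s = LinearMap.id) : Module.Projective A Q :=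
  .of_lifting_property'' fun ψ hψ => h _ ψ hψ

/-- Restriction to the corner `fRf` of a projective module generated by `P f` is projective. -/
lemma projective_cornerRestrict {P : Type u} [AddCommGroup P] [Module Rᵐᵒᵖ P]
    [Module.Projective Rᵐᵒᵖ P]
    (hP : Submodule.span Rᵐᵒᵖ (Set.range fun p : P => op f • p) = ⊤) :
    Module.Projective (hf.Corner)ᵐᵒᵖ (cornerRestrict hf P) := by
  obtain ⟨σ, hσ⟩ := exists_section_idealCover hP
  refine Module.Projective.of_surjective_splits fun N _ _ ψ hψ => ?_
  -- Although `p ↦ n p` is not additive, the `n p` define a map `Φ` out of the free-like module `P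
  -- →₀ fR`, using that `x b` lies in `fRf`. Composing it with `σ` yields the section.
  choose n hn using fun p : P => hψ (tmul R hf.Corner (leftIdeal.gen f) p)
  let Φ : leftIdeal f →+ (P →₀ rightIdeal f) →+ N :=
    AddMonoidHom.mk' (fun b => Finsupp.liftAddHom fun p =>
        AddMonoidHom.mk' (fun x : rightIdeal f => op (cornerMul hf x b) • n p) fun x y => by
          rw [cornerMul_add_left, MulOpposite.op_add, add_smul])
      fun b c => Finsupp.addHom_ext fun p x => by
        simp [cornerMul_add_right, add_smul]
  have Φ_single (b : leftIdeal f) (p : P) (x : rightIdeal f) :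
      Φ b (Finsupp.single p x) = op (cornerMul hf x b) • n p :=
    (Finsupp.liftAddHom_apply_single _ p x)
  have key (b : leftIdeal f) (y : P →₀ rightIdeal f) :
      ψ (Φ b y) = tmul R hf.Corner b (idealCover f P y) := by
    induction y using Finsupp.induction_linear with
    | zero => simp [tmul_zero]
    | add y z hy hz => rw [map_add, map_add, map_add, tmul_add, hy, hz]
    | single p x =>
      have h : op (cornerMul hf x b) • leftIdeal.gen f = (x.1 • b : leftIdeal f) :=
        Subtype.ext (gen_mul_cornerMul hf x b)
      rw [Φ_single, idealCover_single, map_smul, hn, smul_tmul', tmul_smul, h]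
  have balanced (s : R) (b : leftIdeal f) (y : P →₀ rightIdeal f) :
      Φ b (op s • y) = Φ (s • b) y := by
    induction y using Finsupp.induction_linear with
    | zero => simp
    | add y z hy hz => rw [smul_add, map_add, map_add, hy, hz]
    | single p x =>
      rw [Finsupp.smul_single, Φ_single, Φ_single]
      refine congrArg (fun c : hf.Corner => op c • n p) (Subtype.ext ?_)
      exact mul_assoc x.1 s b.1
  have linear (c : (hf.Corner)ᵐᵒᵖ) (b : leftIdeal f) (y : P →₀ rightIdeal f) :
      Φ (c • b) y = c • Φ b y := by
    induction y using Finsupp.induction_linear with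
    | zero => simp
    | add y z hy hz => rw [map_add, map_add, smul_add, hy, hz]
    | single p x =>
      rw [Φ_single, Φ_single, ← mul_smul]
      refine congrArg (fun c : hf.Corner => op c • n p) (Subtype.ext ?_)
      exact (mul_assoc x.1 b.1 (unop c).1).symm
  refine ⟨lift
      (AddMonoidHom.mk' (fun b => (Φ b).comp σ.toAddMonoidHom) fun b c => by
        rw [map_add, AddMonoidHom.add_comp])
      (fun s b p => (congrArg (Φ b) (map_smul σ (op s) p)).trans (balanced s b (σ p)))
      (fun c b p => linear c b (σ p)), LinearMap.ext fun t => ?_⟩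
  induction t using tensor_induction with
  | zero => simp
  | tmul b p =>
    change ψ (Φ b (σ p)) = _
    rw [key, hσ]; rfl
  | add x y hx hy => rw [map_add, map_add, hx, hy]

end

/-! ### Trace submodules, projective covers and envelopes. -/

section

variable {R : Type u} [Ring R] {e : R}

/-- The submodule `M · ⟨f⟩` of a right module `M`. -/
abbrev traceSubmodule (f : R) (M : Type u) [AddCommGroup M] [Module Rᵐᵒᵖ M] :
    Submodule Rᵐᵒᵖ M :=
  Submodule.span Rᵐᵒᵖ (Set.range fun m : M => op f • m)

variable {M N : Type u} [AddCommGroup M] [Module Rᵐᵒᵖ M] [AddCommGroup N] [Module Rᵐᵒᵖ N]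

/-- Left multiples are harmless because `m · (a x) = (m · a) · x`; this is why `m` is generalized in
the induction. -/
lemma op_smul_mem_traceSubmodule {f r : R} (hr : r ∈ TwoSidedIdeal.span ({f} : Set R)) (m : M) :
    op r • m ∈ traceSubmodule f M := by
  induction hr using TwoSidedIdeal.span_induction generalizing m with
  | mem x hx => rw [Set.mem_singleton_iff.1 hx]; exact Submodule.subset_span ⟨m, rfl⟩
  | zero => simp
  | add x y _ _ hx hy => rw [MulOpposite.op_add, add_smul]; exact add_mem (hx m) (hy m)
  | neg x _ hx => rw [MulOpposite.op_neg, neg_smul]; exact neg_mem (hx m)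
  | left_absorb a x _ hx => rw [op_mul, mul_smul]; exact hx _
  | right_absorb a x _ hx => rw [op_mul, mul_smul]; exact Submodule.smul_mem _ _ (hx m)

lemma traceSubmodule_map_eq {f : R} (φ : M →ₗ[Rᵐᵒᵖ] N) (hφ : Function.Surjective φ) :
    (traceSubmodule f M).map φ = traceSubmodule f N := by
  rw [Submodule.map_span, ← Set.range_comp]
  congr 1
  ext n
  constructor
  · rintro ⟨m, rfl⟩; exact ⟨φ m, (map_smul φ _ _).symm⟩
  · rintro ⟨n, rfl⟩
    obtain ⟨m, rfl⟩ := hφ n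
    exact ⟨m, map_smul φ _ _⟩

/-- The projective cover of a module `K = K · ⟨f⟩` has the same property. -/
lemma IsProjectiveCover.traceSubmodule_eq_top {f : R} {g : M →ₗ[Rᵐᵒᵖ] N}
    (hg : IsProjectiveCover g) (hN : traceSubmodule f N = ⊤) : traceSubmodule f M = ⊤ := by
  -- The trace of `M` maps onto that of `N`, which is everything, so together with the kernel it
  -- spans `M`.
  refine hg.superfluous _ (eq_top_iff.2 fun m _ => ?_)
  have hm : g m ∈ (traceSubmodule f M).map g := by
    rw [traceSubmodule_map_eq g hg.surjective, hN]; trivial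
  obtain ⟨m', hm', h⟩ := hm
  rw [← add_sub_cancel m' m]
  exact Submodule.add_mem_sup hm' (LinearMap.mem_ker.2 (by rw [map_sub, h, sub_self]))

namespace IsEnvelope

variable {C X : FGModuleCat.{u} Rᵐᵒᵖ} {f : C ⟶ X}

lemma hom_op_smul_eq_zero (hf : IsEnvelope (modQuotient e) f) (m : C.obj) :
    f.hom.hom (op (1 - e) • m) = 0 := by
  rw [map_smul]
  exact hf.mem _ (TwoSidedIdeal.subset_span rfl) _

/-- The projection of `C` onto `C / C⟨1 - e⟩`. -/
noncomputable def quotientProj (e : R) (C : FGModuleCat.{u} Rᵐᵒᵖ) :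
    C ⟶ FGModuleCat.of Rᵐᵒᵖ (C.obj ⧸ traceSubmodule (1 - e) C.obj) :=
  FGModuleCat.ofHom (traceSubmodule (1 - e) C.obj).mkQ

lemma exists_comp_eq_quotientProj (hf : IsEnvelope (modQuotient e) f) :
    ∃ s, f ≫ s = quotientProj e C := by
  refine hf.exists_factor _ (fun r hr m => ?_) _
  obtain ⟨m, rfl⟩ := Submodule.Quotient.mk_surjective _ m
  exact (Submodule.Quotient.mk_eq_zero _).2 (op_smul_mem_traceSubmodule hr m)

/-- The quotient `C / C⟨1 - e⟩` is itself a test object, so its projection factors through `f`;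
conversely `X` is annihilated by `1 - e`. -/
lemma ker_eq (hf : IsEnvelope (modQuotient e) f) :
    LinearMap.ker f.hom.hom = traceSubmodule (1 - e) C.obj := by
  apply le_antisymm
  · intro m hm
    obtain ⟨s, hs⟩ := hf.exists_comp_eq_quotientProj
    have h : s.hom.hom (f.hom.hom m) = Submodule.Quotient.mk m :=
      LinearMap.congr_fun (congrArg (fun t => t.hom.hom) hs) m
    rw [LinearMap.mem_ker.1 hm, map_zero] at h
    exact (Submodule.Quotient.mk_eq_zero _).1 h.symm
  · rw [Submodule.span_le]
    rintro _ ⟨m, rfl⟩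
    exact hf.hom_op_smul_eq_zero m

/-- Minimality is used here: with `s : X ⟶ C / C⟨1 - e⟩` and the induced `t` back to `X`, the
endomorphism `s ≫ t` fixes `f`, hence is invertible. So `t` is onto, and so is `f`. -/
lemma surjective (hf : IsEnvelope (modQuotient e) f) : Function.Surjective f.hom.hom := by
  obtain ⟨s, hs⟩ := hf.exists_comp_eq_quotientProj
  let t : FGModuleCat.of Rᵐᵒᵖ (C.obj ⧸ traceSubmodule (1 - e) C.obj) ⟶ X :=
    FGModuleCat.ofHom ((traceSubmodule (1 - e) C.obj).liftQ f.hom.hom hf.ker_eq.ge)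
  have ht : quotientProj e C ≫ t = f := rfl
  have : IsIso (s ≫ t) := hf.isIso_of_comp_eq _ (by rw [← Category.assoc, hs, ht])
  intro x
  obtain ⟨m, hm⟩ := Submodule.Quotient.mk_surjective _ (s.hom.hom ((inv (s ≫ t)).hom.hom x))
  refine ⟨m, ?_⟩
  have h : (inv (s ≫ t) ≫ s ≫ t).hom.hom x = x := by rw [IsIso.inv_hom_id]; rfl
  change t.hom.hom (s.hom.hom ((inv (s ≫ t)).hom.hom x)) = x at h
  rw [← hm] at h
  exact h

end IsEnvelope

end

/-! ### The spliced complex and its homology. -/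

namespace EnvelopeConstruction

variable {R : Type u} [Ring R] {e : R} {Ω₀ : FGModuleCat.{u} Rᵐᵒᵖ} (T : EnvelopeConstruction e Ω₀)

instance (i : ℕ) : Module.Projective Rᵐᵒᵖ (T.P i).obj := (T.isProjectiveCover i).projective

lemma range_k (i : ℕ) :
    LinearMap.range (T.k i).hom.hom = traceSubmodule (1 - e) (T.Ω i).obj := by
  rw [← (T.isEnvelope i).ker_eq, (LinearMap.exact_iff.1 (T.isKernel_k i).exact)]

lemma g_h (i : ℕ) (x : (T.Ω (i + 1)).obj) : (T.g i).hom.hom ((T.h i).hom.hom x) = 0 :=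
  (T.isKernel_h i).exact.apply_apply_eq_zero x

/-- Since `m (1 - e) = (m (1 - e)) (1 - e)`, the generators of `Ω i⟨1 - e⟩` are already multiples by
`1 - e` of elements of `K i`. -/
lemma traceSubmodule_K (he : IsIdempotentElem e) (i : ℕ) :
    traceSubmodule (1 - e) (T.K i).obj = ⊤ := by
  refine Submodule.map_injective_of_injective (T.isKernel_k i).injective ?_
  rw [Submodule.map_top, T.range_k]
  apply le_antisymm
  · rw [← T.range_k]; exact LinearMap.map_le_range
  rw [Submodule.span_le]
  rintro _ ⟨m, rfl⟩
  obtain ⟨x, hx⟩ : op (1 - e) • m ∈ LinearMap.range (T.k i).hom.hom := by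
    rw [T.range_k]; exact Submodule.subset_span ⟨m, rfl⟩
  refine ⟨op (1 - e) • x, Submodule.subset_span ⟨x, rfl⟩, ?_⟩
  rw [map_smul, hx, ← mul_smul, ← op_mul, he.one_sub.eq]

lemma traceSubmodule_P (he : IsIdempotentElem e) (i : ℕ) :
    traceSubmodule (1 - e) (T.P i).obj = ⊤ :=
  (T.isProjectiveCover i).traceSubmodule_eq_top (T.traceSubmodule_K he i)

/-- The composite `P i → K i → Ω i`. -/
def coverMap (i : ℕ) : (T.P i).obj ⟶ (T.Ω i).obj := (T.g i).hom ≫ (T.k i).hom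

lemma coverMap_apply (i : ℕ) (x : (T.P i).obj) :
    (T.coverMap i).hom x = (T.k i).hom.hom ((T.g i).hom.hom x) := rfl

lemma exists_coverMap_eq (i : ℕ) (m : (T.Ω i).obj) :
    ∃ x, (T.coverMap i).hom x = op (1 - e) • m := by
  obtain ⟨y, hy⟩ : op (1 - e) • m ∈ LinearMap.range (T.k i).hom.hom := by
    rw [T.range_k]; exact Submodule.subset_span ⟨m, rfl⟩
  obtain ⟨x, rfl⟩ := (T.isProjectiveCover i).surjective y
  exact ⟨x, hy⟩

/-- The differential `P (i + 1) → P i`. -/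
def diff (i : ℕ) : (T.P (i + 1)).obj ⟶ (T.P i).obj := T.coverMap (i + 1) ≫ (T.h i).hom

lemma diff_apply (i : ℕ) (x : (T.P (i + 1)).obj) :
    (T.diff i).hom x = (T.h i).hom.hom ((T.coverMap (i + 1)).hom x) := rfl

lemma coverMap_h (i : ℕ) (x : (T.Ω (i + 1)).obj) :
    (T.coverMap i).hom ((T.h i).hom.hom x) = 0 := by
  rw [coverMap_apply, T.g_h, map_zero]

lemma exists_h_eq (i : ℕ) (x : (T.P i).obj) (hx : (T.coverMap i).hom x = 0) :
    ∃ y, (T.h i).hom.hom y = x := by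
  refine ((T.isKernel_h i).exact x).1 ((T.isKernel_k i).injective ?_)
  rw [map_zero]; exact hx

/-- As `h i` is injective, `diff i` has the same kernel as `coverMap (i + 1)`. -/
lemma exists_h_eq' (i : ℕ) (x : (T.P (i + 1)).obj) (hx : (T.diff i).hom x = 0) :
    ∃ y, (T.h (i + 1)).hom.hom y = x := by
  refine T.exists_h_eq (i + 1) x ((T.isKernel_h i).injective ?_)
  rw [map_zero]; exact hx

lemma diff_h (i : ℕ) (x : (T.Ω (i + 2)).obj) :
    (T.diff i).hom ((T.h (i + 1)).hom.hom x) = 0 := by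
  rw [diff_apply, T.coverMap_h, map_zero]

lemma coverMap_diff (i : ℕ) (x : (T.P (i + 1)).obj) :
    (T.coverMap i).hom ((T.diff i).hom x) = 0 :=
  T.coverMap_h i _

lemma diff_diff (i : ℕ) (x : (T.P (i + 2)).obj) :
    (T.diff i).hom ((T.diff (i + 1)).hom x) = 0 :=
  T.diff_h i _

/-- The complex need not be exact, but its homology is annihilated by `1 - e`, which is all that
`exact_map_leftIdeal` asks for. -/
lemma exists_diff_eq_of_coverMap (i : ℕ) (x : (T.P i).obj) (hx : (T.coverMap i).hom x = 0) :
    ∃ y, (T.diff i).hom y = op (1 - e) • x := by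
  obtain ⟨y, rfl⟩ := T.exists_h_eq i x hx
  obtain ⟨z, hz⟩ := T.exists_coverMap_eq (i + 1) y
  exact ⟨z, by rw [diff_apply, hz, map_smul]⟩

lemma exists_diff_eq_of_diff (i : ℕ) (x : (T.P (i + 1)).obj) (hx : (T.diff i).hom x = 0) :
    ∃ y, (T.diff (i + 1)).hom y = op (1 - e) • x :=
  T.exists_diff_eq_of_coverMap (i + 1) x ((T.isKernel_h i).injective (by rw [map_zero]; exact hx))

lemma diff_comp_diff (i : ℕ) : T.diff (i + 1) ≫ T.diff i = 0 :=
  ModuleCat.hom_ext (LinearMap.ext (T.diff_diff i))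

/-- The complex `⋯ → P 1 → P 0`. -/
noncomputable def complex : ChainComplex (ModuleCat.{u} Rᵐᵒᵖ) ℕ :=
  ChainComplex.of (fun i => (T.P i).obj) T.diff T.diff_comp_diff

lemma complex_d (i : ℕ) : T.complex.d (i + 1) i = T.diff i :=
  ChainComplex.of_d (fun i => (T.P i).obj) T.diff i

/-- The kernel of `P (i + 1) → P i` is `Ω (i + 2)`. -/
noncomputable def isLimitKernelForkH (i : ℕ) :
    Limits.IsLimit (Limits.KernelFork.ofι (f := T.diff i) (T.h (i + 1)).hom
      (ModuleCat.hom_ext (LinearMap.ext (T.diff_h i)))) :=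
  ModuleCat.isLimitKernelFork _ _
    (fun x => ⟨T.exists_h_eq' i x, by rintro ⟨y, rfl⟩; exact T.diff_h i y⟩)
    (T.isKernel_h (i + 1)).injective

/-- Identifies the boundaries inside the cycles `Ω (i + 2)` as the image of `coverMap (i + 2)`, so
that the homology is the cokernel `X (i + 2)`. -/
lemma lift_isLimitKernelForkH (i : ℕ) :
    (T.isLimitKernelForkH i).lift (Limits.KernelFork.ofι (T.diff (i + 1)) (T.diff_comp_diff i)) =
      T.coverMap (i + 2) :=
  Limits.Fork.IsLimit.hom_ext (T.isLimitKernelForkH i)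
    ((T.isLimitKernelForkH i).fac _ Limits.WalkingParallelPair.zero)

lemma exact_coverMap_f (i : ℕ) : Function.Exact (T.coverMap i).hom (T.f i).hom.hom := by
  intro x
  refine ((T.isKernel_k i).exact x).trans ⟨?_, ?_⟩
  · rintro ⟨y, rfl⟩
    obtain ⟨z, rfl⟩ := (T.isProjectiveCover i).surjective y
    exact ⟨z, rfl⟩
  · rintro ⟨y, rfl⟩
    exact ⟨_, rfl⟩

/-- The homology of the complex `P` at `i + 1` is `X (i + 2)`. -/
noncomputable def leftHomologyData (i : ℕ) :
    (ShortComplex.mk (T.diff (i + 1)) (T.diff i) (T.diff_comp_diff i)).LeftHomologyData where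
  K := (T.Ω (i + 2)).obj
  H := (T.X (i + 2)).obj
  i := (T.h (i + 1)).hom
  π := (T.f (i + 2)).hom
  wi := ModuleCat.hom_ext (LinearMap.ext (T.diff_h i))
  hi := T.isLimitKernelForkH i
  wπ := (congrArg (· ≫ (T.f (i + 2)).hom) (T.lift_isLimitKernelForkH i)).trans
    (ModuleCat.hom_ext (LinearMap.ext (T.exact_coverMap_f (i + 2)).apply_apply_eq_zero))
  hπ := ModuleCat.isColimitCokernelCofork _ _
    ((congrArg (fun φ => Function.Exact φ.hom (T.f (i + 2)).hom.hom)
      (T.lift_isLimitKernelForkH i)).mpr (T.exact_coverMap_f (i + 2)))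
    (T.isEnvelope (i + 2)).surjective

/-- The homology of the complex `P` at `i + 1` is `X (i + 2)`. -/
noncomputable def homologyIso (i : ℕ) : T.complex.homology (i + 1) ≅ (T.X (i + 2)).obj :=
  ShortComplex.homologyMapIso
      (T.complex.isoSc' (i + 2) (i + 1) i (by simp) (by simp) ≪≫
        ShortComplex.isoMk
          (S₂ := ShortComplex.mk (T.diff (i + 1)) (T.diff i) (T.diff_comp_diff i))
          (Iso.refl _) (Iso.refl _) (Iso.refl _)
          ((Category.id_comp _).trans
            ((T.complex_d (i + 1)).symm.trans (Category.comp_id _).symm))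
          ((Category.id_comp _).trans ((T.complex_d i).symm.trans (Category.comp_id _).symm))) ≪≫
    (T.leftHomologyData i).homologyIso

/-! ### The projective resolution `F_e P` and the computation of Tor. -/

variable (he : IsIdempotentElem e)

/-- The complex `F_e P`. -/
noncomputable abbrev cornerComplex : ChainComplex (ModuleCat.{u} (Gam he)ᵐᵒᵖ) ℕ :=
  ((functorF he).mapHomologicalComplex _).obj T.complex

instance (i : ℕ) : Projective ((T.cornerComplex he).X i) := by
  have := projective_cornerRestrict he.one_sub (T.traceSubmodule_P he i)
  exact (IsProjective.iff_projective (R := (Gam he)ᵐᵒᵖ)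
    (cornerRestrict he.one_sub (T.P i).obj)).1 this

lemma cornerComplex_exactAt_succ (i : ℕ) : (T.cornerComplex he).ExactAt (i + 1) := by
  rw [HomologicalComplex.exactAt_iff' _ (i + 2) (i + 1) i (by simp) (by simp)]
  rw [ShortComplex.ShortExact.moduleCat_exact_iff_function_exact]
  have h := exact_map_leftIdeal he.one_sub (T.diff (i + 1)).hom (T.diff i).hom (T.diff_diff i)
    (T.exists_diff_eq_of_diff i)
  rw [← T.complex_d, ← T.complex_d] at h
  exact h

lemma diff_comp_coverMap (i : ℕ) : T.diff i ≫ T.coverMap i = 0 :=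
  ModuleCat.hom_ext (LinearMap.ext (T.coverMap_diff i))

/-- The end `F_e (P 1) → F_e (P 0) → F_e (Ω 0)` of the augmented complex. -/
noncomputable abbrev augmentedShortComplex : ShortComplex (ModuleCat.{u} (Gam he)ᵐᵒᵖ) :=
  (ShortComplex.mk (T.diff 0) (T.coverMap 0) (T.diff_comp_coverMap 0)).map (functorF he)

/-- The cokernel of `P 0 → Ω 0` is `X 0`, annihilated by `1 - e`, so the augmentation becomes
surjective after `F_e`. -/
lemma augmentedShortComplex_exact :
    (T.augmentedShortComplex he).Exact ∧ Epi (T.augmentedShortComplex he).g := by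
  refine ⟨?_, ?_⟩
  · rw [ShortComplex.ShortExact.moduleCat_exact_iff_function_exact]
    exact exact_map_leftIdeal he.one_sub (T.diff 0).hom (T.coverMap 0).hom (T.coverMap_diff 0)
      (T.exists_diff_eq_of_coverMap 0)
  · rw [ModuleCat.epi_iff_surjective]
    exact surjective_map_leftIdeal he.one_sub (T.coverMap 0).hom (T.exists_coverMap_eq 0)

/-- The augmentation `F_e (P 0) → F_e (Ω 0)`. -/
noncomputable def augmentation :
    T.cornerComplex he ⟶ (ChainComplex.single₀ _).obj ((functorF he).obj (T.Ω 0).obj) :=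
  (ChainComplex.toSingle₀Equiv _ _).symm ⟨(functorF he).map (T.coverMap 0),
    (congrArg (fun d => (functorF he).map d ≫ (functorF he).map (T.coverMap 0))
      (T.complex_d 0)).trans (T.augmentedShortComplex he).zero⟩

lemma augmentation_f_zero :
    (T.augmentation he).f 0 = (functorF he).map (T.coverMap 0) :=
  ChainComplex.toSingle₀Equiv_symm_apply_f_zero _ _

/-- The complex `F_e P` is a projective resolution of `F_e (Ω 0)`. -/
noncomputable def projectiveResolution :
    ProjectiveResolution ((functorF he).obj (T.Ω 0).obj) where
  complex := T.cornerComplex he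
  π := T.augmentation he
  quasiIso := ⟨fun n => by
    cases n
    -- In degree 0 a quasi-isomorphism to a single module means exactness of the augmented end and
    -- surjectivity of the augmentation.
    · rw [ChainComplex.quasiIsoAt₀_iff, ShortComplex.quasiIso_iff_of_zeros']
      · refine (ShortComplex.exact_and_epi_g_iff_of_iso ?_).2 (T.augmentedShortComplex_exact he)
        exact ShortComplex.isoMk (Iso.refl _) (Iso.refl _) (Iso.refl _)
          ((Category.id_comp _).trans
            ((congrArg (functorF he).map (T.complex_d 0)).symm.trans (Category.comp_id _).symm))
          ((Category.id_comp _).trans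
            ((T.augmentation_f_zero he).symm.trans (Category.comp_id _).symm))
      · exact (T.cornerComplex he).shape 0 0 (by simp)
      all_goals rfl
    · rw [quasiIsoAt_iff_exactAt']
      · exact T.cornerComplex_exactAt_succ he _
      · apply ChainComplex.exactAt_succ_single_obj⟩

/-- The counit identifies `(F_e P) ⊗ (1 - e)R` with `P`. -/
noncomputable def counitIso :
    ((NCTensor.functor (Gam he) R (rightIdeal (1 - e))).mapHomologicalComplex _).obj
      (T.cornerComplex he) ≅ T.complex :=
  HomologicalComplex.Hom.isoOfComponents
    (fun i => (LinearEquiv.ofBijective _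
      (cornerCounit_bijective he.one_sub (T.traceSubmodule_P he i))).toModuleIso)
    fun i j _ => ModuleCat.hom_ext (LinearMap.ext fun x =>
      (cornerCounit_naturality he.one_sub (T.complex.d i j).hom x).symm)

/-- `Tor_{i + 1}` of `F_e (Ω 0)` is `X (i + 2)`. -/
noncomputable def torIso (i : ℕ) :
    (torGam he (i + 1)).obj ((functorF he).obj (T.Ω 0).obj) ≅ (T.X (i + 2)).obj :=
  (T.projectiveResolution he).isoLeftDerivedObj _ (i + 1) ≪≫
    (HomologicalComplex.homologyFunctor _ _ (i + 1)).mapIso (T.counitIso he) ≪≫ T.homologyIso i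

end EnvelopeConstruction

theorem mainTheorem2 {R : Type u} [Ring R] [IsNoetherianRing R] [IsNoetherianRing Rᵐᵒᵖ]
    (hR : IsSemiperfectRing R) {e : R} (he : IsIdempotentElem e)
    (Ω₀ : FGModuleCat.{u} Rᵐᵒᵖ) (T : EnvelopeConstruction e Ω₀) (i : ℕ) (hi : 1 ≤ i) :
    Nonempty ((torGam he i).obj ((functorF he).obj Ω₀.obj) ≅ (T.X (i + 1)).obj) := by
  -- Positive degree matters: in degree 0 every element of `P 0` is a cycle, not only those of `Ω
  -- 1`.
  obtain ⟨i, rfl⟩ := Nat.exists_eq_add_of_le' hi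
  exact ⟨(torGam he (i + 1)).mapIso
    ((functorF he).mapIso (eqToIso (congrArg (·.obj) T.Ω_zero.symm))) ≪≫ T.torIso he i⟩
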